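/- Let $\mathbb{H}$ be the real quaternions with the usual norm and conjugation. An $\mathbb{H}$-vector space is a unital $\mathbb{H}$-bimodule on which the left and right actions of $\mathbb{R}\subseteq\mathbb{H}$ agree. A unital $\mathbb{H}$-$B^*$-algebra is an $\mathbb{H}$-vector space $A$ that is also a unital real algebra (for the induced real vector space structure, $A=0$ being allowed) with $(\gamma a)b=\gamma(ab)$, $(a\gamma)b=a(\gamma b)$, $(ab)\gamma=a(b\gamma)$, with a real-linear involution satisfying $(ab)^*=b^*a^*$, $(\alpha b)^*=b^*\alpha^*$, $(b\alpha)^*=\alpha^*b^*$, and with a complete norm satisfying $\|\alpha a\beta\|\le\|\alpha\|\,\|a\|\,\|\beta\|$, $\|ab\|\le\|a\|\,\|b\|$ and $\|a^*a\|=\|a\|^2$, for all $a,b\in A$ and $\alpha,\beta,\gamma\in\mathbb{H}$. It is normal if $a^*a=aa^*$ for every $a\in A$. A unital $\mathbb{H}$-$*$-homomorphism is a unital ring homomorphism that preserves the involution and both $\mathbb{H}$-actions. Consider the categories 1. of compact Hausdorff spaces (including the empty one) and continuous maps; 2. of unital normal $\mathbb{H}$-$B^*$-algebras and unital $\mathbb{H}$-$*$-homomorphisms;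 3. of unital commutative complex $C^*$-algebras (including $0$) and unital complex $*$-homomorphisms. The contravariant functors $\Omega\mapsto C(\Omega;\mathbb{H})$ from category 1 to category 2 and $\Omega\mapsto C(\Omega;\mathbb{C})$ from category 1 to category 3, acting on morphisms by composition, are (contravariant) equivalences of categories: category 1 is dually equivalent to categories 2 and 3. Categories 2 and 3 are (covariantly) equivalent, by an equivalence which carries $C(\Omega;\mathbb{H})$ to $C(\Omega;\mathbb{C})$ naturally in $\Omega$. Moreover every unital normal $\mathbb{H}$-$B^*$-algebra $A$ is isometrically $\mathbb{H}$-$*$-isomorphic to $C(\Omega;\mathbb{H})$ for some compact Hausdorff space $\Omega$. -/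

import Mathlib

open CategoryTheory Opposite
open scoped Quaternion RightActions

universe u

/-- A (two-sided) quaternion vector space: a unital `ℍ`-bimodule on which the left and the right
action of the centre `ℝ` of `ℍ` agree; the real vector space structure is the induced one.
The right action `x <• β` of `β : ℍ` is the action of `MulOpposite.op β : ℍᵐᵒᵖ`. -/
class QuaternionVectorSpace (X : Type u) [AddCommGroup X] [Module ℝ X] [Module ℍ X]
    [Module ℍᵐᵒᵖ X] : Prop extends SMulCommClass ℍ ℍᵐᵒᵖ X where
  coe_smul : ∀ (r : ℝ) (x : X), (r : ℍ) • x = r • x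
  smul_coe : ∀ (r : ℝ) (x : X), x <• (r : ℍ) = r • x

/-- A unital `ℍ`-algebra with an `ℍ`-involution. -/
class QuaternionInvolutiveAlgebra (A : Type u) [Ring A] [StarRing A] [Algebra ℝ A] [Module ℍ A]
    [Module ℍᵐᵒᵖ A] : Prop extends QuaternionVectorSpace A, StarModule ℝ A where
  left_smul_mul : ∀ (γ : ℍ) (a b : A), (γ • a) * b = γ • (a * b)
  right_smul_mul : ∀ (γ : ℍ) (a b : A), (a <• γ) * b = a * (γ • b)
  mul_right_smul : ∀ (γ : ℍ) (a b : A), (a * b) <• γ = a * (b <• γ)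
  star_left_smul : ∀ (α : ℍ) (b : A), star (α • b) = star b <• star α
  star_right_smul : ∀ (α : ℍ) (b : A), star (b <• α) = star α • star b

/-- A unital `ℍ`-`B*`-algebra: an involutive `ℍ`-algebra with a complete submultiplicative norm that
makes it a normed `ℍ`-bimodule and satisfies `‖a* a‖ = ‖a‖²`. The zero algebra is allowed. -/
class QuaternionBStarAlgebra (A : Type u) [NormedRing A] [StarRing A] [NormedAlgebra ℝ A]
    [Module ℍ A] [Module ℍᵐᵒᵖ A] : Prop
    extends QuaternionInvolutiveAlgebra A, CompleteSpace A, CStarRing A where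
  norm_smul_smul_le : ∀ (α β : ℍ) (x : A), ‖(α • x) <• β‖ ≤ ‖α‖ * ‖x‖ * ‖β‖

/-- Unital `ℍ`-`*`-homomorphisms: unital ring homomorphisms that are `ℍ`-bimodule maps and preserve
the involution. -/
structure QuaternionStarHom (A B : Type u) [Ring A] [StarRing A] [Module ℍ A] [Module ℍᵐᵒᵖ A]
    [Ring B] [StarRing B] [Module ℍ B] [Module ℍᵐᵒᵖ B] extends A →+* B where
  map_left_smul : ∀ (α : ℍ) (a : A), toFun (α • a) = α • toFun a
  map_right_smul : ∀ (α : ℍ) (a : A), toFun (a <• α) = toFun a <• α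
  map_star : ∀ a : A, toFun (star a) = star (toFun a)

/-- A unital normal `ℍ`-`B*`-algebra, i.e. one in which every element is normal. -/
structure UnitalNormalHBStarAlg : Type (u + 1) where
  carrier : Type u
  [normedRing : NormedRing carrier]
  [starRing : StarRing carrier]
  [normedAlgebra : NormedAlgebra ℝ carrier]
  [leftModule : Module ℍ carrier]
  [rightModule : Module ℍᵐᵒᵖ carrier]
  [bStar : QuaternionBStarAlgebra carrier]
  normal : ∀ a : carrier, IsStarNormal a

namespace UnitalNormalHBStarAlg

attribute [instance] normedRing starRing normedAlgebra leftModule rightModule bStar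

instance : CoeSort UnitalNormalHBStarAlg.{u} (Type u) := ⟨carrier⟩

/-- The category of unital normal `ℍ`-`B*`-algebras and unital `ℍ`-`*`-homomorphisms. -/
instance : Category UnitalNormalHBStarAlg.{u} where
  Hom A B := QuaternionStarHom A B
  id A :=
    { RingHom.id A with
      map_left_smul := fun _ _ => rfl
      map_right_smul := fun _ _ => rfl
      map_star := fun _ => rfl }
  comp {A B C} f g :=
    { g.toRingHom.comp f.toRingHom with
      map_left_smul := fun α a =>
        (congrArg g.toFun (f.map_left_smul α a)).trans (g.map_left_smul α (f.toFun a))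
      map_right_smul := fun α a =>
        (congrArg g.toFun (f.map_right_smul α a)).trans (g.map_right_smul α (f.toFun a))
      map_star := fun a => (congrArg g.toFun (f.map_star a)).trans (g.map_star (f.toFun a)) }

end UnitalNormalHBStarAlg

/-- A unital commutative complex `C*`-algebra. -/
structure UnitalCommCStarAlg : Type (u + 1) where
  carrier : Type u
  [commCStarAlgebra : CommCStarAlgebra carrier]

namespace UnitalCommCStarAlg

attribute [instance] commCStarAlgebra

instance : CoeSort UnitalCommCStarAlg.{u} (Type u) := ⟨carrier⟩

/-- The category of unital commutative `C*`-algebras and unital complex `*`-homomorphisms. -/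
instance : Category UnitalCommCStarAlg.{u} where
  Hom A B := A →⋆ₐ[ℂ] B
  id A := StarAlgHom.id ℂ A
  comp f g := StarAlgHom.comp g f

end UnitalCommCStarAlg

/-- `C(Ω; ℍ)` with the pointwise operations and the supremum norm is an `ℍ`-`B*`-algebra. -/
instance ContinuousMap.quaternionBStarAlgebra (X : Type u) [TopologicalSpace X] [CompactSpace X] :
    QuaternionBStarAlgebra C(X, ℍ) where
  smul_comm α β f := by ext1 x; exact smul_comm α β (f x)
  coe_smul r f := by ext1 x; exact Quaternion.coe_mul_eq_smul r (f x)
  smul_coe r f := by ext1 x; exact Quaternion.mul_coe_eq_smul r (f x)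
  star_smul r f := by ext1 x; exact Quaternion.star_smul r (f x)
  left_smul_mul γ a b := by ext1 x; exact mul_assoc γ (a x) (b x)
  right_smul_mul γ a b := by ext1 x; exact mul_assoc (a x) γ (b x)
  mul_right_smul γ a b := by ext1 x; exact mul_assoc (a x) (b x) γ
  star_left_smul α b := by ext1 x; exact star_mul α (b x)
  star_right_smul α b := by ext1 x; exact star_mul (b x) α
  complete := CompleteSpace.complete
  norm_mul_self_le f := CStarRing.norm_mul_self_le f
  norm_smul_smul_le α β f := by
    refine (ContinuousMap.norm_le _ (by positivity)).2 fun x => ?_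
    change ‖α * f x * β‖ ≤ _
    rw [norm_mul, norm_mul]
    gcongr
    exact f.norm_coe_le_norm x

/-- The functor `Ω ↦ C(Ω; ℍ)`, sending `g : Ω' ⟶ Ω` to `f ↦ f ∘ g`. -/
noncomputable def quaternionFunctions : CompHaus.{u}ᵒᵖ ⥤ UnitalNormalHBStarAlg.{u} where
  obj Ω :=
    { carrier := C(Ω.unop, ℍ)
      normal := fun f => ⟨by
        ext1 x
        change star (f x) * f x = f x * star (f x)
        rw [Quaternion.star_mul_self, Quaternion.self_mul_star]⟩ }
  map g :=
    { toFun := fun f => f.comp g.unop.hom.hom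
      map_one' := rfl
      map_mul' := fun _ _ => rfl
      map_zero' := rfl
      map_add' := fun _ _ => rfl
      map_left_smul := fun _ _ => rfl
      map_right_smul := fun _ _ => rfl
      map_star := fun _ => rfl }

/-- The functor `Ω ↦ C(Ω; ℂ)`, sending `g : Ω' ⟶ Ω` to `f ↦ f ∘ g`. -/
noncomputable def complexFunctions : CompHaus.{u}ᵒᵖ ⥤ UnitalCommCStarAlg.{u} where
  obj Ω := { carrier := C(Ω.unop, ℂ) }
  map g := ContinuousMap.compStarAlgHom' ℂ ℂ g.unop.hom.hom

/-- The unit `i` of the quaternions. -/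
def quaternionI : ℍ := ⟨0, 1, 0, 0⟩

/-- The unit `j` of the quaternions. -/
def quaternionJ : ℍ := ⟨0, 0, 1, 0⟩

/-- The unit `k` of the quaternions. -/
def quaternionK : ℍ := ⟨0, 0, 0, 1⟩

@[simp] theorem quaternionI_re : quaternionI.re = 0 := rfl
@[simp] theorem quaternionI_imI : quaternionI.imI = 1 := rfl
@[simp] theorem quaternionI_imJ : quaternionI.imJ = 0 := rfl
@[simp] theorem quaternionI_imK : quaternionI.imK = 0 := rfl

@[simp] theorem quaternionJ_re : quaternionJ.re = 0 := rfl
@[simp] theorem quaternionJ_imI : quaternionJ.imI = 0 := rfl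
@[simp] theorem quaternionJ_imJ : quaternionJ.imJ = 1 := rfl
@[simp] theorem quaternionJ_imK : quaternionJ.imK = 0 := rfl

@[simp] theorem quaternionK_re : quaternionK.re = 0 := rfl
@[simp] theorem quaternionK_imI : quaternionK.imI = 0 := rfl
@[simp] theorem quaternionK_imJ : quaternionK.imJ = 0 := rfl
@[simp] theorem quaternionK_imK : quaternionK.imK = 1 := rfl

theorem quaternionI_mul_self : quaternionI * quaternionI = -1 := by
  ext <;> simp

theorem quaternionJ_mul_self : quaternionJ * quaternionJ = -1 := by
  ext <;> simp

theorem quaternionK_mul_self : quaternionK * quaternionK = -1 := by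
  ext <;> simp

theorem quaternionI_mul_quaternionJ : quaternionI * quaternionJ = quaternionK := by
  ext <;> simp

theorem quaternionJ_mul_quaternionI : quaternionJ * quaternionI = -quaternionK := by
  ext <;> simp

theorem quaternionJ_mul_quaternionK : quaternionJ * quaternionK = quaternionI := by
  ext <;> simp

theorem quaternionK_mul_quaternionJ : quaternionK * quaternionJ = -quaternionI := by
  ext <;> simp

theorem quaternionK_mul_quaternionI : quaternionK * quaternionI = quaternionJ := by
  ext <;> simp

theorem quaternionI_mul_quaternionK : quaternionI * quaternionK = -quaternionJ := by
  ext <;> simp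

theorem star_quaternionI : star quaternionI = -quaternionI := by
  ext <;> simp

theorem star_quaternionJ : star quaternionJ = -quaternionJ := by
  ext <;> simp

theorem star_quaternionK : star quaternionK = -quaternionK := by
  ext <;> simp

theorem Quaternion.eq_units_expansion (γ : ℍ) :
    γ = (γ.re : ℍ) + quaternionI * (γ.imI : ℍ) + quaternionJ * (γ.imJ : ℍ) +
      quaternionK * (γ.imK : ℍ) := by
  ext <;> simp

namespace QuaternionInvolutiveAlgebra

variable {A : Type u} [Ring A] [StarRing A] [Algebra ℝ A] [Module ℍ A] [Module ℍᵐᵒᵖ A]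
  [QuaternionInvolutiveAlgebra A]

theorem one_right_smul (γ : ℍ) : (1 : A) <• γ = γ • (1 : A) := by
  have h := right_smul_mul γ (1 : A) 1
  rwa [mul_one, one_mul] at h

variable (A) in
/-- The ring homomorphism `γ ↦ γ • 1`. -/
noncomputable def scalar : ℍ →+* A where
  toFun γ := γ • (1 : A)
  map_one' := one_smul _ _
  map_mul' γ δ := by rw [left_smul_mul, one_mul, mul_smul]
  map_zero' := zero_smul _ _
  map_add' γ δ := add_smul _ _ _

theorem scalar_apply (γ : ℍ) : scalar A γ = γ • (1 : A) := rfl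

theorem scalar_mul (γ : ℍ) (a : A) : scalar A γ * a = γ • a := by
  rw [scalar_apply, left_smul_mul, one_mul]

theorem mul_scalar (γ : ℍ) (a : A) : a * scalar A γ = a <• γ := by
  rw [scalar_apply, ← one_right_smul, ← mul_right_smul, mul_one]

theorem star_scalar (γ : ℍ) : star (scalar A γ) = scalar A (star γ) := by
  rw [scalar_apply, scalar_apply, star_left_smul, star_one, one_right_smul]

theorem scalar_coe (r : ℝ) : scalar A (r : ℍ) = algebraMap ℝ A r := by
  rw [scalar_apply, QuaternionVectorSpace.coe_smul, Algebra.algebraMap_eq_smul_one]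

omit [Module ℍ A] [Module ℍᵐᵒᵖ A] [QuaternionInvolutiveAlgebra A] in
theorem commute_skew_of_isSelfAdjoint (hN : ∀ a : A, IsStarNormal a) {s : A}
    (hs : IsSelfAdjoint s) {k : A} (hk : star k = -k) : Commute s k := by
  have h := (hN (k + s)).star_comm_self.eq
  have h' : (2 : ℝ) • (s * k) = (2 : ℝ) • (k * s) := by
    rw [star_add, hs.star_eq, hk] at h
    simp only [add_mul, mul_add, neg_mul, mul_neg] at h
    rw [two_smul, two_smul, ← sub_eq_zero]
    rw [← sub_eq_zero] at h
    rw [← h]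
    abel
  exact smul_right_injective A (two_ne_zero' ℝ) h'

theorem commute_scalar_of_isSelfAdjoint (hN : ∀ a : A, IsStarNormal a) {s : A}
    (hs : IsSelfAdjoint s) (γ : ℍ) : Commute s (scalar A γ) := by
  rw [Quaternion.eq_units_expansion γ]
  simp only [map_add, map_mul, scalar_coe]
  have hr (r : ℝ) : Commute s (algebraMap ℝ A r) := (Algebra.commutes r s).symm
  refine (((hr _).add_right (.mul_right ?_ (hr _))).add_right (.mul_right ?_ (hr _))).add_right
    (.mul_right ?_ (hr _))
  all_goals
    refine commute_skew_of_isSelfAdjoint hN hs ?_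
    simp [star_scalar, star_quaternionI, star_quaternionJ, star_quaternionK]

theorem isSelfAdjoint_scalar_mul (hN : ∀ a : A, IsStarNormal a) {s : A}
    (hs : IsSelfAdjoint s) {γ : ℍ} (hγ : star γ = -γ) :
    star (scalar A γ * s) = -(scalar A γ * s) := by
  rw [star_mul, star_scalar, hγ, hs.star_eq, map_neg, mul_neg,
    (commute_scalar_of_isSelfAdjoint hN hs γ).eq]

/-- In a normal involutive quaternion algebra self-adjoint elements commute. -/
theorem commute_of_isSelfAdjoint (hN : ∀ a : A, IsStarNormal a) {s t : A}
    (hs : IsSelfAdjoint s) (ht : IsSelfAdjoint t) : Commute s t := by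
  have h := commute_skew_of_isSelfAdjoint hN hs
    (isSelfAdjoint_scalar_mul hN ht star_quaternionI)
  have h' := h.mul_right (commute_scalar_of_isSelfAdjoint hN hs quaternionI)
  rw [mul_assoc, (commute_scalar_of_isSelfAdjoint hN ht _).eq, ← mul_assoc, ← map_mul,
    quaternionI_mul_self] at h'
  simpa using h'

/-- The skew-adjoint elements that commute with the quaternions vanish. -/
theorem eq_zero_of_skew_of_commute (hN : ∀ a : A, IsStarNormal a) {k : A} (hk : star k = -k)
    (hI : Commute k (scalar A quaternionI)) (hJ : Commute k (scalar A quaternionJ)) : k = 0 := by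
  have hs : IsSelfAdjoint (scalar A quaternionI * k) := by
    rw [IsSelfAdjoint, star_mul, star_scalar, star_quaternionI, hk, map_neg, neg_mul_neg, hI.eq]
  have h := (commute_scalar_of_isSelfAdjoint hN hs quaternionJ).eq
  rw [mul_assoc, hJ.eq, ← mul_assoc, ← mul_assoc, ← map_mul, ← map_mul,
    quaternionI_mul_quaternionJ, quaternionJ_mul_quaternionI, map_neg, neg_mul] at h
  have h2 : (2 : ℝ) • (scalar A quaternionK * k) = 0 := by
    rw [two_smul]; nth_rewrite 1 [h]; exact neg_add_cancel _
  have h3 := (smul_eq_zero_iff_right (two_ne_zero' ℝ)).1 h2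
  have h4 : scalar A quaternionK * (scalar A quaternionK * k) = 0 := by rw [h3, mul_zero]
  rw [← mul_assoc, ← map_mul, quaternionK_mul_self] at h4
  simpa using h4

/-- A skew-adjoint element `k` satisfies `k = i k i + j k j + l k l`. -/
theorem skew_eq (hN : ∀ a : A, IsStarNormal a) {k : A} (hk : star k = -k) :
    scalar A quaternionI * k * scalar A quaternionI +
      scalar A quaternionJ * k * scalar A quaternionJ +
      scalar A quaternionK * k * scalar A quaternionK = k := by
  have hII := congrArg (scalar A) quaternionI_mul_self
  have hJJ := congrArg (scalar A) quaternionJ_mul_self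
  have hIJ := congrArg (scalar A) quaternionI_mul_quaternionJ
  have hJI := congrArg (scalar A) quaternionJ_mul_quaternionI
  have sI : star (scalar A quaternionI) = -scalar A quaternionI := by
    rw [star_scalar, star_quaternionI, map_neg]
  have sJ : star (scalar A quaternionJ) = -scalar A quaternionJ := by
    rw [star_scalar, star_quaternionJ, map_neg]
  have hz := eq_zero_of_skew_of_commute hN
    (k := k - (scalar A quaternionI * k * scalar A quaternionI +
      scalar A quaternionJ * k * scalar A quaternionJ +
      scalar A quaternionK * k * scalar A quaternionK))
  simp only [map_mul, map_neg, map_one] at hII hJJ hIJ hJI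
  rw [← hIJ] at hJI hz ⊢
  generalize scalar A quaternionI = I at *
  generalize scalar A quaternionJ = J at *
  have hII' (x : A) : I * (I * x) = -x := by rw [← mul_assoc, hII, neg_one_mul]
  have hJJ' (x : A) : J * (J * x) = -x := by rw [← mul_assoc, hJJ, neg_one_mul]
  have hJI' (x : A) : J * (I * x) = -(I * (J * x)) := by
    rw [← mul_assoc, hJI, neg_mul, mul_assoc]
  refine (sub_eq_zero.1 (hz ?_ ?_ ?_)).symm
  · simp only [star_sub, star_add, star_mul, sI, sJ, hk, mul_assoc, mul_neg, neg_mul, hJI, neg_neg]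
    abel
  all_goals
    simp only [Commute, SemiconjBy, sub_mul, mul_sub, add_mul, mul_add, mul_assoc, mul_neg,
      hII', hJJ', hJI', hII, hJJ, hJI, neg_neg, mul_one]
    abel

end QuaternionInvolutiveAlgebra

namespace QuaternionInvolutiveAlgebra

variable {A : Type u} [Ring A] [StarRing A] [Algebra ℝ A] [Module ℍ A] [Module ℍᵐᵒᵖ A]
  [QuaternionInvolutiveAlgebra A]

theorem isSelfAdjoint_component {k : A} (hk : star k = -k) {γ : ℍ} (hγ : star γ = -γ) :
    IsSelfAdjoint ((-(1 / 2) : ℝ) • (scalar A γ * k + k * scalar A γ)) := by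
  rw [IsSelfAdjoint, star_smul, star_add, star_mul, star_mul, hk, star_scalar, hγ, map_neg,
    neg_mul_neg, neg_mul_neg, star_trivial, add_comm]

theorem scalar_mul_component (k : A) {γ : ℍ} (hγ : γ * γ = -1) :
    scalar A γ * ((-(1 / 2) : ℝ) • (scalar A γ * k + k * scalar A γ)) =
      (1 / 2 : ℝ) • (k - scalar A γ * k * scalar A γ) := by
  rw [mul_smul_comm, mul_add, ← mul_assoc, ← mul_assoc, ← map_mul, hγ, map_neg, map_one,
    neg_one_mul]
  module

/-- Every element is a combination of the quaternion units with self-adjoint coefficients. -/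
theorem exists_units_expansion (hN : ∀ a : A, IsStarNormal a) (a : A) :
    ∃ x y z w : A, IsSelfAdjoint x ∧ IsSelfAdjoint y ∧ IsSelfAdjoint z ∧ IsSelfAdjoint w ∧
      a = x + scalar A quaternionI * y + scalar A quaternionJ * z + scalar A quaternionK * w := by
  set k : A := (1 / 2 : ℝ) • (a - star a) with hkdef
  have hk : star k = -k := by
    rw [hkdef, star_smul, star_sub, star_star, star_trivial]; module
  refine ⟨(1 / 2 : ℝ) • (a + star a), _, _, _, ?_, isSelfAdjoint_component hk star_quaternionI,
    isSelfAdjoint_component hk star_quaternionJ, isSelfAdjoint_component hk star_quaternionK, ?_⟩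
  · rw [IsSelfAdjoint, star_smul, star_add, star_star, star_trivial, add_comm]
  · rw [scalar_mul_component k quaternionI_mul_self, scalar_mul_component k quaternionJ_mul_self,
      scalar_mul_component k quaternionK_mul_self]
    have h := skew_eq hN hk
    have ha : a = (1 / 2 : ℝ) • (a + star a) + k := by rw [hkdef]; module
    calc a = (1 / 2 : ℝ) • (a + star a) + ((3 / 2 : ℝ) • k - (1 / 2 : ℝ) • k) := by
          nth_rewrite 1 [ha]; module
      _ = _ := by nth_rewrite 3 [← h]; module

variable (A) in
/-- The elements that commute with the unit `i`. -/
noncomputable def complexPart : StarSubalgebra ℝ A :=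
  StarSubalgebra.centralizer ℝ {scalar A quaternionI}

theorem mem_complexPart_iff {a : A} :
    a ∈ complexPart A ↔ scalar A quaternionI * a = a * scalar A quaternionI := by
  simp [complexPart, StarSubalgebra.mem_centralizer_iff, star_scalar, star_quaternionI]

theorem mem_complexPart_of_isSelfAdjoint (hN : ∀ a : A, IsStarNormal a) {s : A}
    (hs : IsSelfAdjoint s) : s ∈ complexPart A :=
  mem_complexPart_iff.2 (commute_scalar_of_isSelfAdjoint hN hs _).symm.eq

/-- The complex part is commutative. -/
theorem mul_comm_of_mem_complexPart (hN : ∀ a : A, IsStarNormal a) {a b : A}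
    (ha : a ∈ complexPart A) (hb : b ∈ complexPart A) : a * b = b * a := by
  have key (c : A) (hc : c ∈ complexPart A) : ∃ s t : A, IsSelfAdjoint s ∧ IsSelfAdjoint t ∧
      c = s + scalar A quaternionI * t := by
    have hc' := star_mem hc
    rw [mem_complexPart_iff] at hc hc'
    refine ⟨(1 / 2 : ℝ) • (c + star c), (-(1 / 2) : ℝ) • (scalar A quaternionI * (c - star c)),
      ?_, ?_, ?_⟩
    · rw [IsSelfAdjoint, star_smul, star_add, star_star, star_trivial, add_comm]
    · rw [IsSelfAdjoint, star_smul, star_mul, star_sub, star_star, star_trivial, star_scalar,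
        star_quaternionI, map_neg, sub_mul, mul_sub, mul_neg, mul_neg, hc, hc']
      congr 1; abel
    · rw [mul_smul_comm, ← mul_assoc, ← map_mul, quaternionI_mul_self, map_neg, map_one,
        neg_one_mul]
      module
  obtain ⟨s, t, hs, ht, rfl⟩ := key a ha
  rw [mem_complexPart_iff] at hb
  obtain ⟨s', t', hs', ht', rfl⟩ := key b (mem_complexPart_iff.2 hb)
  have hI : Commute (scalar A quaternionI) (s' + scalar A quaternionI * t') := hb
  have h1 {r : A} (hr : IsSelfAdjoint r) : Commute r (s' + scalar A quaternionI * t') :=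
    (commute_of_isSelfAdjoint hN hr hs').add_right
      ((commute_scalar_of_isSelfAdjoint hN hr _).mul_right (commute_of_isSelfAdjoint hN hr ht'))
  exact ((h1 hs).add_left (hI.mul_left (h1 ht))).eq

variable (A) in
/-- The inclusion of the complex numbers in the complex part. -/
noncomputable def complexScalar : ℂ →+* complexPart A :=
  ((scalar A).comp (Quaternion.ofComplex : ℂ →ₐ[ℝ] ℍ).toRingHom).codRestrict (complexPart A)
    fun z => mem_complexPart_iff.2 <| by
      simp only [RingHom.comp_apply, ← map_mul]
      congr 1
      ext <;> simp

end QuaternionInvolutiveAlgebra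

namespace UnitalNormalHBStarAlg

open QuaternionInvolutiveAlgebra

noncomputable instance complexPartAlgebra (A : UnitalNormalHBStarAlg.{u}) :
    Algebra ℂ (complexPart A) :=
  (complexScalar A).toAlgebra' fun z b => Subtype.ext <|
    mul_comm_of_mem_complexPart A.normal (complexScalar A z).2 b.2

theorem coe_complex_smul (A : UnitalNormalHBStarAlg.{u}) (z : ℂ) (b : complexPart A) :
    ((z • b : complexPart A) : A) = (z : ℍ) • (b : A) := by
  rw [Algebra.smul_def]
  exact scalar_mul _ _

theorem norm_left_smul_le (A : UnitalNormalHBStarAlg.{u}) (γ : ℍ) (a : A) :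
    ‖γ • a‖ ≤ ‖γ‖ * ‖a‖ := by
  simpa using QuaternionBStarAlgebra.norm_smul_smul_le γ 1 a

theorem isClosed_complexPart (A : UnitalNormalHBStarAlg.{u}) :
    IsClosed (complexPart A : Set A) := by
  rw [complexPart, StarSubalgebra.coe_centralizer]
  exact Set.isClosed_centralizer _

theorem norm_coeComplex (z : ℂ) : ‖(z : ℍ)‖ = ‖z‖ := by
  rw [← sq_eq_sq₀ (norm_nonneg _) (norm_nonneg _), sq, ← Quaternion.normSq_eq_norm_mul_self,
    Complex.sq_norm, Quaternion.normSq_def', Complex.normSq_apply]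
  simp only [Quaternion.re_coeComplex, Quaternion.imI_coeComplex, Quaternion.imJ_coeComplex,
    Quaternion.imK_coeComplex]
  ring

noncomputable instance complexPartCommCStarAlgebra (A : UnitalNormalHBStarAlg.{u}) :
    CommCStarAlgebra (complexPart A) where
  __ := SubringClass.toNormedRing (complexPart A)
  mul_comm a b := Subtype.ext (mul_comm_of_mem_complexPart A.normal a.2 b.2)
  toCompleteSpace := (isClosed_complexPart A).completeSpace_coe
  __ := complexPartAlgebra A
  norm_smul_le z b := by
    change ‖((z • b : complexPart A) : A)‖ ≤ _
    rw [coe_complex_smul]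
    simpa [norm_coeComplex] using norm_left_smul_le A (z : ℍ) b
  star_mul a b := Subtype.ext (star_mul (a : A) (b : A))
  star_add a b := Subtype.ext (star_add (a : A) (b : A))
  star_smul z b := by
    apply Subtype.ext
    change star ((z • b : complexPart A) : A) = ((star z • star b : complexPart A) : A)
    have h : star (z : ℍ) = ((star z : ℂ) : ℍ) := by ext <;> simp
    rw [coe_complex_smul, coe_complex_smul, star_left_smul, ← mul_scalar, ← scalar_mul, h]
    exact mul_comm_of_mem_complexPart A.normal (star_mem b.2) (complexScalar A (star z)).2
  norm_mul_self_le b := CStarRing.norm_mul_self_le (b : A)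

/-- The functor sending a unital normal `ℍ`-`B*`-algebra to its elements commuting with `i`. -/
noncomputable def complexPartFunctor : UnitalNormalHBStarAlg.{u} ⥤ UnitalCommCStarAlg.{u} where
  obj A := { carrier := complexPart A }
  map {A B} f :=
    { toFun := fun a => ⟨f.toFun a, by
        have h := congrArg f.toFun (mem_complexPart_iff.1 a.2)
        rwa [scalar_mul, mul_scalar, f.map_left_smul, f.map_right_smul, ← scalar_mul,
          ← mul_scalar, ← mem_complexPart_iff] at h⟩
      map_one' := Subtype.ext f.map_one'
      map_zero' := Subtype.ext f.map_zero'
      map_mul' := fun a b => Subtype.ext (f.map_mul' a b)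
      map_add' := fun a b => Subtype.ext (f.map_add' a b)
      commutes' := fun z => Subtype.ext <| by
        change f.toFun ((z : ℍ) • (1 : A)) = (z : ℍ) • (1 : B)
        rw [f.map_left_smul]
        exact congrArg _ f.map_one'
      map_star' := fun a => Subtype.ext (f.map_star a) }

end UnitalNormalHBStarAlg

section Gelfand

open WeakDual CharacterSpace

theorem CharacterSpace.homeoEval_symm_apply {X : Type u} [TopologicalSpace X] [CompactSpace X]
    [T2Space X] (φ : characterSpace ℂ C(X, ℂ)) (f : C(X, ℂ)) :
    f ((homeoEval X ℂ).symm φ) = φ f := by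
  conv_rhs => rw [← (homeoEval X ℂ).apply_symm_apply φ]
  rfl

instance : complexFunctions.{u}.Faithful where
  map_injective {Ω Ω'} g h hgh := by
    apply Quiver.Hom.unop_inj
    ext x
    apply (homeoEval Ω.unop ℂ).injective
    apply CharacterSpace.ext
    intro f
    exact congrArg (fun F : C(Ω.unop, ℂ) →⋆ₐ[ℂ] C(Ω'.unop, ℂ) => F f x) hgh

theorem StarAlgHom.exists_eq_comp_continuousMap {X Y : Type u} [TopologicalSpace X]
    [CompactSpace X] [T2Space X] [TopologicalSpace Y] [CompactSpace Y]
    (φ : C(X, ℂ) →⋆ₐ[ℂ] C(Y, ℂ)) : ∃ g : C(Y, X), ∀ f, f.comp g = φ f :=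
  ⟨((homeoEval X ℂ).symm : C(characterSpace ℂ C(X, ℂ), X)).comp
      ((compContinuousMap φ).comp (continuousMapEval Y ℂ)), fun f => ContinuousMap.ext fun y =>
    CharacterSpace.homeoEval_symm_apply (compContinuousMap φ (continuousMapEval Y ℂ y)) f⟩

instance : complexFunctions.{u}.Full where
  map_surjective {Ω Ω'} φ := by
    let ψ : C(Ω.unop, ℂ) →⋆ₐ[ℂ] C(Ω'.unop, ℂ) := φ
    obtain ⟨g, hg⟩ := ψ.exists_eq_comp_continuousMap
    exact ⟨(CompHausLike.ofHom _ g).op, StarAlgHom.ext hg⟩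

/-- Star algebra isomorphisms give isomorphisms in the category of commutative `C*`-algebras. -/
def UnitalCommCStarAlg.isoOfStarAlgEquiv {A B : UnitalCommCStarAlg.{u}} (e : A ≃⋆ₐ[ℂ] B) :
    A ≅ B where
  hom := (e : A →⋆ₐ[ℂ] B)
  inv := (e.symm : B →⋆ₐ[ℂ] A)
  hom_inv_id := StarAlgHom.ext e.symm_apply_apply
  inv_hom_id := StarAlgHom.ext e.apply_symm_apply

instance : complexFunctions.{u}.EssSurj where
  mem_essImage A := ⟨op (CompHaus.of (characterSpace ℂ A)),
    ⟨(UnitalCommCStarAlg.isoOfStarAlgEquiv (gelfandStarTransform A)).symm⟩⟩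

instance : complexFunctions.{u}.IsEquivalence where

end Gelfand

namespace UnitalNormalHBStarAlg

open QuaternionInvolutiveAlgebra

theorem continuous_coeComplex : Continuous (fun z : ℂ => (z : ℍ)) :=
  (Quaternion.ofComplex : ℂ →ₐ[ℝ] ℍ).toLinearMap.continuous_of_finiteDimensional

theorem mem_complexPart_continuousMap_iff (Ω : CompHaus.{u}) (f : C(Ω, ℍ)) :
    f ∈ complexPart C(Ω, ℍ) ↔ ∀ x, (f x).imJ = 0 ∧ (f x).imK = 0 := by
  rw [mem_complexPart_iff, scalar_mul, mul_scalar, ContinuousMap.ext_iff]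
  refine forall_congr' fun x => ?_
  change quaternionI * f x = f x * quaternionI ↔ _
  rw [Quaternion.ext_iff]
  simp only [Quaternion.re_mul, Quaternion.imI_mul, Quaternion.imJ_mul, Quaternion.imK_mul,
    quaternionI_re, quaternionI_imI, quaternionI_imJ, quaternionI_imK]
  constructor
  · rintro ⟨-, -, h3, h4⟩
    exact ⟨by linarith, by linarith⟩
  · rintro ⟨h1, h2⟩
    simp [h1, h2]

/-- The inclusion of `C(Ω; ℂ)` in the complex part of `C(Ω; ℍ)`. -/
noncomputable def complexPartContinuousMapHom (Ω : CompHaus.{u}) :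
    C(Ω, ℂ) →⋆ₐ[ℂ] complexPart (quaternionFunctions.obj (op Ω)) where
  toFun f := ⟨⟨fun x => (f x : ℍ), continuous_coeComplex.comp f.continuous⟩,
    (mem_complexPart_continuousMap_iff Ω _).2 fun _ => ⟨rfl, rfl⟩⟩
  map_one' := Subtype.ext <| ContinuousMap.ext fun _ => Quaternion.coeComplex_one
  map_zero' := Subtype.ext <| ContinuousMap.ext fun _ => Quaternion.coeComplex_zero
  map_mul' f g := Subtype.ext <| ContinuousMap.ext fun x => Quaternion.coeComplex_mul (f x) (g x)
  map_add' f g := Subtype.ext <| ContinuousMap.ext fun x => Quaternion.coeComplex_add (f x) (g x)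
  commutes' z := Subtype.ext <| ContinuousMap.ext fun _ => (mul_one (z : ℍ)).symm
  map_star' f := Subtype.ext <| ContinuousMap.ext fun x => by
    change ((star (f x) : ℂ) : ℍ) = star (f x : ℍ)
    ext <;> simp

theorem complexPartContinuousMapHom_bijective (Ω : CompHaus.{u}) :
    Function.Bijective (complexPartContinuousMapHom Ω) := by
  refine ⟨fun f g h => ContinuousMap.ext fun x => ?_, fun ⟨f, hf⟩ => ?_⟩
  · have hx : (f x : ℍ) = (g x : ℍ) :=
      congrArg (fun F : C(Ω, ℍ) => F x) (congrArg Subtype.val h)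
    exact Complex.ext (congrArg QuaternionAlgebra.re hx) (congrArg QuaternionAlgebra.imI hx)
  · have hf' := (mem_complexPart_continuousMap_iff Ω f).1 hf
    let f' : C(Ω, ℍ) := f
    refine ⟨⟨fun x => ⟨(f' x).re, (f' x).imI⟩, ?_⟩, ?_⟩
    · exact Complex.equivRealProdCLM.symm.continuous.comp
        ((Quaternion.continuous_re.comp f'.continuous).prodMk
          (Quaternion.continuous_imI.comp f'.continuous))
    · refine Subtype.ext <| ContinuousMap.ext fun x => ?_
      change (((⟨(f' x).re, (f' x).imI⟩ : ℂ) : ℂ) : ℍ) = f' x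
      exact Quaternion.ext _ _ rfl rfl (hf' x).1.symm (hf' x).2.symm

/-- The complex part of `C(Ω; ℍ)` is `C(Ω; ℂ)`, naturally in `Ω`. -/
noncomputable def quaternionFunctionsCompComplexPart :
    quaternionFunctions.{u} ⋙ complexPartFunctor ≅ complexFunctions :=
  (NatIso.ofComponents
    (fun Ω => UnitalCommCStarAlg.isoOfStarAlgEquiv (A := complexFunctions.obj Ω)
      (B := (quaternionFunctions ⋙ complexPartFunctor).obj Ω)
      (StarAlgEquiv.ofBijective (complexPartContinuousMapHom Ω.unop)
        (complexPartContinuousMapHom_bijective Ω.unop)))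
    fun _ => rfl).symm

theorem hom_ext {A B : UnitalNormalHBStarAlg.{u}} {f g : A ⟶ B}
    (h : ∀ a : A, f.toFun a = g.toFun a) : f = g := by
  have key (f g : QuaternionStarHom A B) (h : f.toRingHom = g.toRingHom) : f = g := by
    cases f; cases g; cases h; rfl
  exact key f g (RingHom.ext h)

instance : complexPartFunctor.{u}.Faithful where
  map_injective {A B} f g h := by
    have hs (s : A) (hs : IsSelfAdjoint s) : f.toFun s = g.toFun s :=
      congrArg Subtype.val (congrArg (fun F : complexPart A →⋆ₐ[ℂ] complexPart B =>
        F ⟨s, mem_complexPart_of_isSelfAdjoint A.normal hs⟩) h)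
    refine hom_ext fun a => ?_
    obtain ⟨x, y, z, w, hx, hy, hz, hw, rfl⟩ := exists_units_expansion A.normal a
    simp only [scalar_mul]
    rw [f.map_add', f.map_add', f.map_add', g.map_add', g.map_add', g.map_add']
    simp only [f.map_left_smul, g.map_left_smul, hs _ hx, hs _ hy, hs _ hz, hs _ hw]

end UnitalNormalHBStarAlg

/-- The real part of a quaternion-valued continuous function. -/
noncomputable def ContinuousMap.quaternionRe {X : Type u} [TopologicalSpace X]
    (f : C(X, ℍ)) : C(X, ℝ) :=
  ⟨fun x => (f x).re, Quaternion.continuous_re.comp f.continuous⟩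

/-- The `i`-component of a quaternion-valued continuous function. -/
noncomputable def ContinuousMap.quaternionImI {X : Type u} [TopologicalSpace X]
    (f : C(X, ℍ)) : C(X, ℝ) :=
  ⟨fun x => (f x).imI, Quaternion.continuous_imI.comp f.continuous⟩

/-- The `j`-component of a quaternion-valued continuous function. -/
noncomputable def ContinuousMap.quaternionImJ {X : Type u} [TopologicalSpace X]
    (f : C(X, ℍ)) : C(X, ℝ) :=
  ⟨fun x => (f x).imJ, Quaternion.continuous_imJ.comp f.continuous⟩

/-- The `k`-component of a quaternion-valued continuous function. -/
noncomputable def ContinuousMap.quaternionImK {X : Type u} [TopologicalSpace X]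
    (f : C(X, ℍ)) : C(X, ℝ) :=
  ⟨fun x => (f x).imK, Quaternion.continuous_imK.comp f.continuous⟩

theorem ContinuousMap.exists_quaternion_components {X : Type u} [TopologicalSpace X]
    (x y z w : C(X, ℝ)) : ∃ f : C(X, ℍ), f.quaternionRe = x ∧ f.quaternionImI = y ∧
      f.quaternionImJ = z ∧ f.quaternionImK = w := by
  have hc (f : C(X, ℝ)) : Continuous fun t => ((f t : ℝ) : ℍ) :=
    Quaternion.continuous_coe.comp f.continuous
  refine ⟨⟨fun t => (x t : ℍ) + quaternionI * (y t : ℍ) + quaternionJ * (z t : ℍ) +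
    quaternionK * (w t : ℍ), (((hc x).add (continuous_const.mul (hc y))).add
      (continuous_const.mul (hc z))).add (continuous_const.mul (hc w))⟩, ?_, ?_, ?_, ?_⟩
  all_goals
    ext t
    simp [quaternionRe, quaternionImI, quaternionImJ, quaternionImK]

namespace UnitalNormalHBStarAlg

open QuaternionInvolutiveAlgebra WeakDual

section Extension

variable {A : UnitalNormalHBStarAlg.{u}} {X : Type u} [TopologicalSpace X]
  (g : C(X, ℝ) →ₐ[ℝ] A)

/-- The quaternion-linear extension of a real-linear map on the real-valued functions. -/
noncomputable def quaternionExtend (f : C(X, ℍ)) : A :=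
  g f.quaternionRe + scalar A quaternionI * g f.quaternionImI +
    scalar A quaternionJ * g f.quaternionImJ + scalar A quaternionK * g f.quaternionImK

theorem quaternionExtend_add (p q : C(X, ℍ)) :
    quaternionExtend g (p + q) = quaternionExtend g p + quaternionExtend g q := by
  have h0 : (p + q).quaternionRe = p.quaternionRe + q.quaternionRe := rfl
  have h1 : (p + q).quaternionImI = p.quaternionImI + q.quaternionImI := rfl
  have h2 : (p + q).quaternionImJ = p.quaternionImJ + q.quaternionImJ := rfl
  have h3 : (p + q).quaternionImK = p.quaternionImK + q.quaternionImK := rfl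
  simp only [quaternionExtend, h0, h1, h2, h3, map_add, mul_add]
  abel

variable {g} (hg : ∀ f, IsSelfAdjoint (g f))
include hg

theorem quaternionExtend_mul (p q : C(X, ℍ)) :
    quaternionExtend g (p * q) = quaternionExtend g p * quaternionExtend g q := by
  have h0 : (p * q).quaternionRe = p.quaternionRe * q.quaternionRe -
      p.quaternionImI * q.quaternionImI - p.quaternionImJ * q.quaternionImJ -
      p.quaternionImK * q.quaternionImK := ContinuousMap.ext fun x => Quaternion.re_mul _ _
  have h1 : (p * q).quaternionImI = p.quaternionRe * q.quaternionImI +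
      p.quaternionImI * q.quaternionRe + p.quaternionImJ * q.quaternionImK -
      p.quaternionImK * q.quaternionImJ := ContinuousMap.ext fun x => Quaternion.imI_mul _ _
  have h2 : (p * q).quaternionImJ = p.quaternionRe * q.quaternionImJ -
      p.quaternionImI * q.quaternionImK + p.quaternionImJ * q.quaternionRe +
      p.quaternionImK * q.quaternionImI := ContinuousMap.ext fun x => Quaternion.imJ_mul _ _
  have h3 : (p * q).quaternionImK = p.quaternionRe * q.quaternionImK +
      p.quaternionImI * q.quaternionImJ - p.quaternionImJ * q.quaternionImI +
      p.quaternionImK * q.quaternionRe := ContinuousMap.ext fun x => Quaternion.imK_mul _ _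
  have hc (γ : ℍ) (f : C(X, ℝ)) : g f * scalar A γ = scalar A γ * g f :=
    commute_scalar_of_isSelfAdjoint A.normal (hg f) γ
  have hc' (γ : ℍ) (f : C(X, ℝ)) (a : A) : g f * (scalar A γ * a) = scalar A γ * (g f * a) := by
    rw [← mul_assoc, hc, mul_assoc]
  have hs (γ δ : ℍ) (a : A) : scalar A γ * (scalar A δ * a) = scalar A (γ * δ) * a := by
    rw [map_mul, mul_assoc]
  simp only [quaternionExtend, h0, h1, h2, h3, map_add, map_sub, map_mul g, mul_add, mul_sub,
    add_mul, mul_assoc, hc', hs, quaternionI_mul_self, quaternionJ_mul_self,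
    quaternionK_mul_self, quaternionI_mul_quaternionJ, quaternionJ_mul_quaternionI,
    quaternionJ_mul_quaternionK, quaternionK_mul_quaternionJ, quaternionK_mul_quaternionI,
    quaternionI_mul_quaternionK, map_neg, map_one, neg_mul, one_mul]
  abel

omit hg in
theorem quaternionExtend_scalar [CompactSpace X] (γ : ℍ) :
    quaternionExtend g (scalar C(X, ℍ) γ) = scalar A γ := by
  have h0 : (scalar C(X, ℍ) γ).quaternionRe = algebraMap ℝ C(X, ℝ) γ.re :=
    ContinuousMap.ext fun x => by
      change (γ * 1).re = _
      simp
  have h1 : (scalar C(X, ℍ) γ).quaternionImI = algebraMap ℝ C(X, ℝ) γ.imI :=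
    ContinuousMap.ext fun x => by
      change (γ * 1).imI = _
      simp
  have h2 : (scalar C(X, ℍ) γ).quaternionImJ = algebraMap ℝ C(X, ℝ) γ.imJ :=
    ContinuousMap.ext fun x => by
      change (γ * 1).imJ = _
      simp
  have h3 : (scalar C(X, ℍ) γ).quaternionImK = algebraMap ℝ C(X, ℝ) γ.imK :=
    ContinuousMap.ext fun x => by
      change (γ * 1).imK = _
      simp
  rw [quaternionExtend, h0, h1, h2, h3]
  conv_rhs => rw [Quaternion.eq_units_expansion γ]
  simp only [AlgHom.commutes, map_add, map_mul, scalar_coe]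

theorem quaternionExtend_left_smul [CompactSpace X] (γ : ℍ) (f : C(X, ℍ)) :
    quaternionExtend g (γ • f) = γ • quaternionExtend g f := by
  rw [← scalar_mul, quaternionExtend_mul hg, quaternionExtend_scalar, scalar_mul]

theorem quaternionExtend_right_smul [CompactSpace X] (γ : ℍ) (f : C(X, ℍ)) :
    quaternionExtend g (f <• γ) = quaternionExtend g f <• γ := by
  rw [← mul_scalar, quaternionExtend_mul hg, quaternionExtend_scalar, mul_scalar]

theorem quaternionExtend_star (f : C(X, ℍ)) :
    quaternionExtend g (star f) = star (quaternionExtend g f) := by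
  have h0 : (star f).quaternionRe = f.quaternionRe :=
    ContinuousMap.ext fun x => Quaternion.re_star (f x)
  have h1 : (star f).quaternionImI = -f.quaternionImI :=
    ContinuousMap.ext fun x => Quaternion.imI_star (f x)
  have h2 : (star f).quaternionImJ = -f.quaternionImJ :=
    ContinuousMap.ext fun x => Quaternion.imJ_star (f x)
  have h3 : (star f).quaternionImK = -f.quaternionImK :=
    ContinuousMap.ext fun x => Quaternion.imK_star (f x)
  simp only [quaternionExtend, h0, h1, h2, h3, star_add, (hg _).star_eq, map_neg,
    isSelfAdjoint_scalar_mul A.normal (hg _) star_quaternionI,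
    isSelfAdjoint_scalar_mul A.normal (hg _) star_quaternionJ,
    isSelfAdjoint_scalar_mul A.normal (hg _) star_quaternionK, mul_neg]

theorem norm_quaternionExtend [CompactSpace X] (hn : ∀ f, ‖g f‖ = ‖f‖) (f : C(X, ℍ)) :
    ‖quaternionExtend g f‖ = ‖f‖ := by
  let r : C(X, ℝ) := ⟨fun x => Quaternion.normSq (f x),
    Quaternion.continuous_normSq.comp f.continuous⟩
  have hr (x : X) : (star f * f) x = ((r x : ℝ) : ℍ) := Quaternion.star_mul_self (f x)
  have h0 : (star f * f).quaternionRe = r :=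
    ContinuousMap.ext fun x => by
      change ((star f * f) x).re = r x
      rw [hr, Quaternion.re_coe]
  have h1 : (star f * f).quaternionImI = 0 :=
    ContinuousMap.ext fun x => by
      change ((star f * f) x).imI = 0
      rw [hr, Quaternion.imI_coe]
  have h2 : (star f * f).quaternionImJ = 0 :=
    ContinuousMap.ext fun x => by
      change ((star f * f) x).imJ = 0
      rw [hr, Quaternion.imJ_coe]
  have h3 : (star f * f).quaternionImK = 0 :=
    ContinuousMap.ext fun x => by
      change ((star f * f) x).imK = 0
      rw [hr, Quaternion.imK_coe]
  have hnorm : ‖r‖ = ‖star f * f‖ := by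
    rw [ContinuousMap.norm_eq_iSup_norm, ContinuousMap.norm_eq_iSup_norm]
    simp only [hr, Quaternion.norm_coe]
  have h : quaternionExtend g (star f * f) = g r := by
    rw [quaternionExtend, h0, h1, h2, h3]
    simp
  rw [quaternionExtend_mul hg, quaternionExtend_star hg] at h
  rw [← mul_self_inj_of_nonneg (norm_nonneg _) (norm_nonneg _), ← CStarRing.norm_star_mul_self, h,
    hn, hnorm, CStarRing.norm_star_mul_self]

end Extension

end UnitalNormalHBStarAlg

namespace UnitalNormalHBStarAlg

open QuaternionInvolutiveAlgebra WeakDual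

/-- The real-valued continuous functions on the character space of the complex part, as elements
of the algebra. -/
noncomputable def realFunctionsHom (A : UnitalNormalHBStarAlg.{u}) :
    C(characterSpace ℂ (complexPart A), ℝ) →ₐ[ℝ] A where
  __ := (complexPart A).subtype.toRingHom.comp
    (((gelfandStarTransform (complexPart A)).symm : _ →⋆ₐ[ℂ] complexPart A).toRingHom.comp
      (RingHom.compLeftContinuous _ Complex.ofRealHom Complex.continuous_ofReal))
  commutes' r := by
    have h := (gelfandStarTransform (complexPart A)).symm.toAlgEquiv.commutes (r : ℂ)
    refine (congrArg Subtype.val h).trans ?_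
    change scalar A ((r : ℂ) : ℍ) = _
    rw [Quaternion.coeComplex_coe, scalar_coe]

theorem realFunctionsHom_apply (A : UnitalNormalHBStarAlg.{u})
    (f : C(characterSpace ℂ (complexPart A), ℝ)) :
    realFunctionsHom A f = ((gelfandStarTransform (complexPart A)).symm
      ⟨fun x => (f x : ℂ), Complex.continuous_ofReal.comp f.continuous⟩ : complexPart A) := rfl

theorem isSelfAdjoint_realFunctionsHom (A : UnitalNormalHBStarAlg.{u})
    (f : C(characterSpace ℂ (complexPart A), ℝ)) : IsSelfAdjoint (realFunctionsHom A f) := by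
  rw [realFunctionsHom_apply, IsSelfAdjoint]
  change ((star _ : complexPart A) : A) = _
  rw [← map_star]
  congr 2
  exact ContinuousMap.ext fun x => Complex.conj_ofReal _

theorem norm_realFunctionsHom (A : UnitalNormalHBStarAlg.{u})
    (f : C(characterSpace ℂ (complexPart A), ℝ)) : ‖realFunctionsHom A f‖ = ‖f‖ := by
  have h (b : complexPart A) : ‖(b : A)‖ = ‖gelfandStarTransform (complexPart A) b‖ :=
    ((gelfandTransform_isometry (complexPart A)).norm_map_of_map_zero (map_zero _) b).symm
  rw [realFunctionsHom_apply, h, StarAlgEquiv.apply_symm_apply,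
    ContinuousMap.norm_eq_iSup_norm, ContinuousMap.norm_eq_iSup_norm]
  simp only [ContinuousMap.coe_mk, Complex.norm_real]

theorem exists_realFunctionsHom_eq (A : UnitalNormalHBStarAlg.{u}) {s : A}
    (hs : IsSelfAdjoint s) : ∃ f, realFunctionsHom A f = s := by
  let b : complexPart A := ⟨s, mem_complexPart_of_isSelfAdjoint A.normal hs⟩
  have hb : star b = b := Subtype.ext hs
  let F := gelfandStarTransform (complexPart A) b
  have hF : star F = F := by rw [← map_star, hb]
  refine ⟨⟨fun x => (F x).re, Complex.continuous_re.comp F.continuous⟩, ?_⟩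
  rw [realFunctionsHom_apply]
  have h : (⟨fun x => ((F x).re : ℂ), Complex.continuous_ofReal.comp
      (Complex.continuous_re.comp F.continuous)⟩ : C(_, ℂ)) = F :=
    ContinuousMap.ext fun x => Complex.conj_eq_iff_re.1 (DFunLike.congr_fun hF x)
  exact (congrArg (fun G => (((gelfandStarTransform (complexPart A)).symm G : complexPart A) : A))
    h).trans (congrArg Subtype.val ((gelfandStarTransform (complexPart A)).symm_apply_apply b))

/-- The character space of the complex part. -/
noncomputable def spectrumSpace (A : UnitalNormalHBStarAlg.{u}) : CompHaus.{u} :=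
  CompHaus.of (characterSpace ℂ (complexPart A))

/-- The quaternion-linear extension of the inverse Gelfand transform of the complex part. -/
noncomputable def inverseTransform (A : UnitalNormalHBStarAlg.{u}) :
    quaternionFunctions.obj (op (spectrumSpace A)) ⟶ A :=
  have hscalar := quaternionExtend_scalar (g := realFunctionsHom A)
  { toFun := quaternionExtend (realFunctionsHom A)
    map_one' := by
      have h := hscalar 1
      rwa [map_one, map_one] at h
    map_mul' := quaternionExtend_mul (isSelfAdjoint_realFunctionsHom A)
    map_zero' := by
      have h := hscalar 0
      rwa [map_zero, map_zero] at h
    map_add' := quaternionExtend_add _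
    map_left_smul := quaternionExtend_left_smul (isSelfAdjoint_realFunctionsHom A)
    map_right_smul := quaternionExtend_right_smul (isSelfAdjoint_realFunctionsHom A)
    map_star := quaternionExtend_star (isSelfAdjoint_realFunctionsHom A) }

theorem isometry_inverseTransform (A : UnitalNormalHBStarAlg.{u}) :
    Isometry (inverseTransform A).toFun :=
  AddMonoidHomClass.isometry_of_norm (inverseTransform A).toRingHom
    (norm_quaternionExtend (isSelfAdjoint_realFunctionsHom A) (norm_realFunctionsHom A))

theorem inverseTransform_surjective (A : UnitalNormalHBStarAlg.{u}) :
    Function.Surjective (inverseTransform A).toFun := by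
  intro a
  obtain ⟨x, y, z, w, hx, hy, hz, hw, rfl⟩ := exists_units_expansion A.normal a
  obtain ⟨x, rfl⟩ := exists_realFunctionsHom_eq A hx
  obtain ⟨y, rfl⟩ := exists_realFunctionsHom_eq A hy
  obtain ⟨z, rfl⟩ := exists_realFunctionsHom_eq A hz
  obtain ⟨w, rfl⟩ := exists_realFunctionsHom_eq A hw
  obtain ⟨f, rfl, rfl, rfl, rfl⟩ := ContinuousMap.exists_quaternion_components x y z w
  exact ⟨f, rfl⟩

/-- A bijective morphism is an isomorphism. -/
noncomputable def isoOfBijective {A B : UnitalNormalHBStarAlg.{u}} (f : A ⟶ B)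
    (hf : Function.Bijective f.toFun) : A ≅ B :=
  let e : A ≃+* B := RingEquiv.ofBijective f.toRingHom hf
  have he (b : B) : f.toFun (e.symm b) = b := e.apply_symm_apply b
  { hom := f
    inv :=
      { (e.symm : B →+* A) with
        map_left_smul := fun γ b => hf.1 <| by
          refine (he _).trans ?_
          rw [f.map_left_smul]
          exact congrArg (γ • ·) (he b).symm
        map_right_smul := fun γ b => hf.1 <| by
          refine (he _).trans ?_
          rw [f.map_right_smul]
          exact congrArg (· <• γ) (he b).symm
        map_star := fun b => hf.1 <| by
          refine (he _).trans ?_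
          rw [f.map_star]
          exact congrArg star (he b).symm }
    hom_inv_id := hom_ext e.symm_apply_apply
    inv_hom_id := hom_ext he }

theorem exists_isometric_iso (A : UnitalNormalHBStarAlg.{u}) : ∃ (Ω : CompHaus.{u})
    (e : A ≅ quaternionFunctions.{u}.obj (op Ω)), Isometry e.hom.toFun := by
  let e := isoOfBijective (inverseTransform A)
    ⟨(isometry_inverseTransform A).injective, inverseTransform_surjective A⟩
  refine ⟨spectrumSpace A, e.symm, (isometry_inverseTransform A).right_inv (fun a => ?_)⟩
  exact congrArg (fun F : QuaternionStarHom A A => F.toFun a) e.inv_hom_id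

instance : quaternionFunctions.{u}.EssSurj where
  mem_essImage A := by
    obtain ⟨Ω, e, -⟩ := exists_isometric_iso A
    exact ⟨op Ω, ⟨e.symm⟩⟩

instance : quaternionFunctions.{u}.Faithful :=
  Functor.Faithful.of_comp_iso quaternionFunctionsCompComplexPart

instance : quaternionFunctions.{u}.Full :=
  Functor.Full.of_comp_faithful_iso quaternionFunctionsCompComplexPart

instance : quaternionFunctions.{u}.IsEquivalence where

instance : complexPartFunctor.{u}.IsEquivalence :=
  have : (quaternionFunctions.{u} ⋙ complexPartFunctor.{u}).IsEquivalence :=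
    Functor.isEquivalence_of_iso quaternionFunctionsCompComplexPart.symm
  Functor.isEquivalence_of_comp_left quaternionFunctions complexPartFunctor

end UnitalNormalHBStarAlg

theorem mainTheorem12 :
    quaternionFunctions.{u}.IsEquivalence ∧
    complexFunctions.{u}.IsEquivalence ∧
    (∃ E : UnitalNormalHBStarAlg.{u} ≌ UnitalCommCStarAlg.{u},
      Nonempty (quaternionFunctions.{u} ⋙ E.functor ≅ complexFunctions.{u})) ∧
    (∀ A : UnitalNormalHBStarAlg.{u}, ∃ (Ω : CompHaus.{u})
      (e : A ≅ quaternionFunctions.{u}.obj (op Ω)), Isometry e.hom.toFun) :=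
  ⟨inferInstance, inferInstance,
    ⟨UnitalNormalHBStarAlg.complexPartFunctor.asEquivalence,
      ⟨UnitalNormalHBStarAlg.quaternionFunctionsCompComplexPart⟩⟩,
    UnitalNormalHBStarAlg.exists_isometric_iso⟩
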